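/- For real $\alpha>-1$, $\beta\in\mathbb R$, $\mu\in\mathbb C$ and $t\ge 0$ let $$\varphi_\mu^{(\alpha,\beta)}(t)={}_2F_1\Bigl(\tfrac{\alpha+\beta+1-i\mu}{2},\tfrac{\alpha+\beta+1+i\mu}{2};\alpha+1;-\sinh^2 t\Bigr)$$ be the Jacobi function, where ${}_2F_1(a,b;c;x)$ for real $x<1$ denotes the analytic continuation to $(-\infty,1)$ of the Gauss hypergeometric series $\sum_{n\ge0}\frac{(a)_n(b)_n}{(c)_n\,n!}x^n$, and put $\rho=\alpha+\beta+1$. Let $\beta\ge-1/2$. Then there is a constant $C=C(\beta)$, depending only on $\beta$, such that for all $t\ge0$, all real $\alpha>\max(\beta,0)$ and all $\lambda\in\mathbb R$, $$\Bigl|\varphi_{i\rho-\lambda}^{(\alpha,\beta)}(t)-e^{i\lambda\ln(\cosh t)}\Bigr|\le C\,\frac{|\lambda|\,\min(1,t)}{\sqrt\alpha}.$$ -/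

import Mathlib

/-- `F : ℝ → ℂ` is the analytic continuation to the real half-line `(-∞, 1)` of the Gauss
hypergeometric series `∑ (a)ₙ (b)ₙ / (c)ₙ · xⁿ / n!`, which itself converges for `-1 < x < 1`
(Mathlib's `ordinaryHypergeometric` is the sum of that series, and is junk outside the disc of
convergence). -/
def IsGaussContinuation (a b c : ℂ) (F : ℝ → ℂ) : Prop :=
  AnalyticOnNhd ℝ F (Set.Iio 1) ∧
    ∀ x ∈ Set.Ioo (-1 : ℝ) 1, F x = ordinaryHypergeometric a b c (x : ℂ)

/-- The continuation is unique, so that `gaussHypergeometric` below does not depend on a choice. -/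
theorem IsGaussContinuation.unique {a b c : ℂ} {F G : ℝ → ℂ}
    (hF : IsGaussContinuation a b c F) (hG : IsGaussContinuation a b c G) :
    Set.EqOn F G (Set.Iio 1) := by
  refine hF.1.eqOn_of_preconnected_of_eventuallyEq hG.1 isPreconnected_Iio
    (show (0 : ℝ) ∈ Set.Iio 1 by simp) ?_
  filter_upwards [Ioo_mem_nhds (show (-1 : ℝ) < 0 by norm_num) (show (0 : ℝ) < 1 by norm_num)]
    with x hx
  rw [hF.2 x hx, hG.2 x hx]

/-- The Gauss hypergeometric function `₂F₁(a, b; c; x)` at real arguments `x < 1`, that is, the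
principal branch of the analytically continued hypergeometric series. -/
noncomputable def gaussHypergeometric (a b c : ℂ) : ℝ → ℂ :=
  Classical.epsilon (IsGaussContinuation a b c)

/-- The Jacobi function
`φ_μ^{(α,β)}(t) = ₂F₁((α+β+1-iμ)/2, (α+β+1+iμ)/2; α+1; -sinh² t)` with spectral parameter
`μ ∈ ℂ`. -/
noncomputable def jacobiFunction (α β : ℝ) (μ : ℂ) (t : ℝ) : ℂ :=
  gaussHypergeometric (((α : ℂ) + β + 1 - Complex.I * μ) / 2)
    (((α : ℂ) + β + 1 + Complex.I * μ) / 2) ((α : ℂ) + 1) (-(Real.sinh t) ^ 2)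

open Complex Filter Topology Metric

/-! Pfaff's transformation turns the Jacobi function at μ = iρ − λ into e^{iλ ln cosh t} f(tanh² t)
with f = ₂F₁(−β − iλ/2, −iλ/2; α+1; ·) (`jacobiFunction_eq_exp_mul`). The phase has modulus 1, so it
remains to bound f − 1 on [0, 1).

This is an energy estimate (`gauss_ode_norm_sub_one_le`). For E = 4x(1−x)|f'|² + λ²|f|², the
derivative E' contains the damping term −8α|f'|², and the bounded weight exp(−|β| arcsin(2x−1))
absorbs the only term of indefinite sign. Hence ∫|f'|² ≤ λ²e^{|β|π}/(8α), and Cauchy–Schwarz with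
f(0) = 1 gives |f(s) − 1|² ≤ sλ²e^{|β|π}/(8α). The claim follows from s = tanh² t ≤ min(1,t)².

Pfaff's formula is a uniqueness statement: both sides are analytic at 0, equal 1 there and solve the
same Gauss equation. -/

/-! ### The Gauss series and its differential equation -/

theorem hasSum_nat_mul_pow_deriv {u : ℕ → ℂ} {F : ℂ → ℂ}
    (h : ∀ z ∈ ball (0 : ℂ) 1, HasSum (fun n => u n * z ^ n) (F z)) {z : ℂ}
    (hz : z ∈ ball (0 : ℂ) 1) :
    HasSum (fun n => (n * u n) * z ^ n) (z * deriv F z) := by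
  obtain ⟨r, hzr, hr1⟩ := exists_between (mem_ball_zero_iff.1 hz)
  have hr0 : 0 ≤ r := (norm_nonneg z).trans hzr.le
  have hu : Summable fun n => ‖u n‖ * r ^ n := by
    have := (h (r : ℂ) (by simpa [abs_of_nonneg hr0] using hr1)).summable.norm
    simpa [abs_of_nonneg hr0] using this
  have key := hasSum_deriv_of_summable_norm (F := fun n (w : ℂ) => u n * w ^ n) (U := ball 0 r) hu
    (fun n => by fun_prop) isOpen_ball (fun n w hw => by
      rw [norm_mul, norm_pow]
      have := (mem_ball_zero_iff.1 hw).le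
      gcongr) (mem_ball_zero_iff.2 hzr)
  have hF : (fun w : ℂ => ∑' n, u n * w ^ n) =ᶠ[𝓝 z] F := by
    filter_upwards [isOpen_ball.mem_nhds hz] with w hw using (h w hw).tsum_eq
  rw [hF.deriv_eq] at key
  refine (key.mul_left z).congr_fun fun n => ?_
  rcases n with _ | n
  · simp
  · simp only [deriv_const_mul_field', deriv_pow_field, Nat.add_sub_cancel]
    ring

/-- The radius is 1 except in degenerate cases, where it is infinite. The case λ = 0 is degenerate,
since then b = 0. -/
theorem ordinaryHypergeometricSeries_one_le_radius (a b c : ℂ) :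
    1 ≤ (ordinaryHypergeometricSeries ℂ a b c).radius := by
  by_cases h : ∀ k : ℕ, (k : ℂ) ≠ -a ∧ (k : ℂ) ≠ -b ∧ (k : ℂ) ≠ -c
  · exact (ordinaryHypergeometricSeries_radius_eq_one ℂ a b c h).ge
  · push Not at h
    obtain ⟨k, hk⟩ := h
    have : (ordinaryHypergeometricSeries ℂ a b c).radius = ⊤ := by
      by_cases h1 : (k : ℂ) = -a
      · rw [← neg_neg a, ← h1]; exact ordinaryHypergeometric_radius_top_of_neg_nat₁ ℂ b c
      by_cases h2 : (k : ℂ) = -b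
      · rw [← neg_neg b, ← h2]; exact ordinaryHypergeometric_radius_top_of_neg_nat₂ ℂ a c
      rw [← neg_neg c, ← hk h1 h2]; exact ordinaryHypergeometric_radius_top_of_neg_nat₃ ℂ a b
    simp [this]

theorem hasFPowerSeriesOnBall_ordinaryHypergeometric (a b c : ℂ) :
    HasFPowerSeriesOnBall (ordinaryHypergeometric a b c : ℂ → ℂ)
      (ordinaryHypergeometricSeries ℂ a b c) 0 1 :=
  (FormalMultilinearSeries.hasFPowerSeriesOnBall _
    (one_pos.trans_le (ordinaryHypergeometricSeries_one_le_radius a b c))).mono one_pos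
    (ordinaryHypergeometricSeries_one_le_radius a b c)

theorem analyticOnNhd_ordinaryHypergeometric (a b c : ℂ) :
    AnalyticOnNhd ℂ (ordinaryHypergeometric a b c : ℂ → ℂ) (ball 0 1) := by
  have := (hasFPowerSeriesOnBall_ordinaryHypergeometric a b c).analyticOnNhd
  rwa [← ENNReal.ofReal_one, Metric.eball_ofReal] at this

theorem hasSum_ordinaryHypergeometric (a b c : ℂ) {z : ℂ} (hz : z ∈ ball (0 : ℂ) 1) :
    HasSum (fun n => ordinaryHypergeometricCoefficient a b c n * z ^ n)
      (ordinaryHypergeometric a b c z) := by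
  have := (hasFPowerSeriesOnBall_ordinaryHypergeometric a b c).hasSum (y := z)
    (by rwa [← ENNReal.ofReal_one, Metric.eball_ofReal])
  simp only [zero_add, ordinaryHypergeometricSeries_apply_eq, smul_eq_mul] at this
  exact this

theorem ordinaryHypergeometricCoefficient_succ (a b c : ℂ) (hc : ∀ n : ℕ, c + n ≠ 0) (n : ℕ) :
    ((n + 1 : ℕ) : ℂ) * (c + n) * ordinaryHypergeometricCoefficient a b c (n + 1)
      = (a + n) * (b + n) * ordinaryHypergeometricCoefficient a b c n := by
  have h1 : ((n : ℂ) + 1) ≠ 0 := by exact_mod_cast n.succ_ne_zero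
  have h2 := hc n
  simp only [ordinaryHypergeometricCoefficient, ascPochhammer_succ_eval, Nat.factorial_succ,
    Nat.cast_mul, mul_inv_rev, Nat.cast_add, Nat.cast_one]
  field_simp

/-- The Gauss differential equation. -/
theorem ordinaryHypergeometric_ode (a b c : ℂ) (hc : ∀ n : ℕ, c + n ≠ 0) {z : ℂ}
    (hz : z ∈ ball (0 : ℂ) 1) (hz0 : z ≠ 0) :
    z * (1 - z) * deriv (deriv (ordinaryHypergeometric a b c)) z
      + (c - (a + b + 1) * z) * deriv (ordinaryHypergeometric a b c) z
      - a * b * ordinaryHypergeometric a b c z = 0 := by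
  set F : ℂ → ℂ := ordinaryHypergeometric a b c
  set u := ordinaryHypergeometricCoefficient a b c
  have h0 : ∀ z ∈ ball (0 : ℂ) 1, HasSum (fun n => u n * z ^ n) (F z) :=
    fun z hz => hasSum_ordinaryHypergeometric a b c hz
  have h1 : ∀ z ∈ ball (0 : ℂ) 1, HasSum (fun n => (n * u n) * z ^ n) (z * deriv F z) :=
    fun z hz => hasSum_nat_mul_pow_deriv h0 hz
  have h2 := hasSum_nat_mul_pow_deriv h1 hz
  have hd : deriv (fun w => w * deriv F w) z = deriv F z + z * deriv (deriv F) z := by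
    have := (hasDerivAt_id' z).fun_mul
      ((analyticOnNhd_ordinaryHypergeometric a b c).deriv z hz).differentiableAt.hasDerivAt
    rw [this.deriv, one_mul]
  rw [hd] at h2
  -- With θ = z d/dz, which multiplies the n-th coefficient by n, the equation reads θ(θ+c−1)F =
  -- z(θ+a)(θ+b)F. The left side has no constant term, so its index is shifted by one to match the
  -- right.
  have hL := h2.add ((h1 z hz).mul_left (c - 1))
  have hR := ((h2.add ((h1 z hz).mul_left (a + b))).add ((h0 z hz).mul_left (a * b))).mul_left z
  rw [← hasSum_nat_add_iff' 1] at hL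
  have := hL.unique (hR.congr_fun fun n => ?_)
  · refine mul_left_cancel₀ hz0 ?_
    simp at this
    linear_combination this
  · have := ordinaryHypergeometricCoefficient_succ a b c hc n
    push_cast at this ⊢
    linear_combination (z ^ (n + 1)) * this

/-! ### Uniqueness of the analytic solution at the origin -/

/-- An analytic solution of the Gauss equation that vanishes at the origin is zero. -/
theorem gauss_ode_eq_zero_of_apply_zero {a b c : ℂ} (hc : ∀ n : ℕ, c + n ≠ 0) {y : ℂ → ℂ}
    (hy : AnalyticAt ℂ y 0) (hy0 : y 0 = 0)
    (hode : ∀ᶠ z in 𝓝[≠] (0 : ℂ), z * (1 - z) * deriv (deriv y) z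
      + (c - (a + b + 1) * z) * deriv y z - a * b * y z = 0) :
    ∀ᶠ z in 𝓝 (0 : ℂ), y z = 0 := by
  by_contra hne
  obtain ⟨n, g, hg, hg0, hyg⟩ := hy.exists_eventuallyEq_pow_smul_nonzero_iff.2 hne
  simp only [sub_zero, smul_eq_mul] at hyg
  rcases n with _ | m
  · have := hyg.self_of_nhds
    simp [hy0] at this
    exact hg0 this.symm
  -- Here y = z^(m+1) g with g(0) ≠ 0 and y' = z^m h. The lowest-order coefficient of the equation
  -- is (m+1)(c+m)g(0), which is nonzero because the second indicial exponent 1 − c is not a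
  -- positive integer.
  set h : ℂ → ℂ := fun z => (m + 1) * g z + z * deriv g z with hh
  have hha : AnalyticAt ℂ h 0 := by
    have := hg.deriv
    fun_prop
  have hy1 : deriv y =ᶠ[𝓝 0] fun z => z ^ m * h z := by
    have e : y =ᶠ[𝓝 0] fun z => z ^ (m + 1) * g z := hyg
    filter_upwards [e.deriv, hg.eventually_analyticAt] with z hz hgz
    rw [hz, ((hasDerivAt_pow (m + 1) z).fun_mul hgz.differentiableAt.hasDerivAt).deriv, hh]
    simp only [Nat.add_sub_cancel]
    push_cast
    ring
  have hy2 : ∀ᶠ z in 𝓝 0, z * deriv (deriv y) z = z ^ m * (m * h z + z * deriv h z) := by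
    filter_upwards [hy1.deriv, hha.eventually_analyticAt] with z hz hhz
    rw [hz, ((hasDerivAt_pow m z).fun_mul hhz.differentiableAt.hasDerivAt).deriv]
    rcases m with _ | m
    · simp
    · simp only [Nat.add_sub_cancel]
      push_cast
      ring
  have hfin : (fun z => (1 - z) * (m * h z + z * deriv h z) + (c - (a + b + 1) * z) * h z
      - a * b * (z * g z)) =ᶠ[𝓝[≠] 0] fun _ => 0 := by
    filter_upwards [hode, hyg.filter_mono nhdsWithin_le_nhds, hy1.filter_mono nhdsWithin_le_nhds,
      hy2.filter_mono nhdsWithin_le_nhds, self_mem_nhdsWithin] with z e e0 e1 e2 hz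
    refine mul_left_cancel₀ (pow_ne_zero m hz) ?_
    rw [e0, e1] at e
    linear_combination e - (1 - z) * e2
  have hcont : ContinuousAt (fun z => (1 - z) * (m * h z + z * deriv h z)
      + (c - (a + b + 1) * z) * h z - a * b * (z * g z)) 0 := by
    have h1 := hha.continuousAt
    have h2 := hha.deriv.continuousAt
    have h3 := hg.continuousAt
    fun_prop
  have := tendsto_nhds_unique (hcont.tendsto.mono_left nhdsWithin_le_nhds)
    (tendsto_const_nhds.congr' hfin.symm)
  have hm1 : (m : ℂ) + 1 ≠ 0 := by exact_mod_cast m.succ_ne_zero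
  have : (c + m) * ((m + 1) * g 0) = 0 := by
    simp [hh] at this
    linear_combination this
  exact mul_ne_zero (hc m) (mul_ne_zero hm1 hg0) this

/-! ### Pfaff's transformation -/

theorem norm_div_sub_one_lt_one {z : ℂ} (hz : z.re < 1 / 2) : ‖z / (z - 1)‖ < 1 := by
  have h1 : z - 1 ≠ 0 := fun h => by
    have := congrArg re h
    simp at this
    linarith
  rw [norm_div, div_lt_one (norm_pos_iff.2 h1), ← sq_lt_sq₀ (norm_nonneg _) (norm_nonneg _),
    Complex.sq_norm, Complex.sq_norm, normSq_apply, normSq_apply]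
  simp
  nlinarith

/-- The right-hand side of Pfaff's transformation formula. -/
noncomputable def pfaffTransform (a b c z : ℂ) : ℂ :=
  (1 - z) ^ (-b) * ordinaryHypergeometric (c - a) b c (z / (z - 1))

theorem one_sub_mem_slitPlane {z : ℂ} (hz : z.re < 1 / 2) : 1 - z ∈ slitPlane :=
  Or.inl (by simp; linarith)

theorem analyticOnNhd_pfaffTransform (a b c : ℂ) :
    AnalyticOnNhd ℂ (pfaffTransform a b c) {z | z.re < 1 / 2} := by
  intro z hz
  have h1 : z - 1 ≠ 0 := fun h => by
    have := one_sub_mem_slitPlane hz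
    rw [← neg_sub, h] at this
    simp at this
  have h2 : AnalyticAt ℂ (fun z : ℂ => z / (z - 1)) z := by fun_prop (disch := assumption)
  have h3 : AnalyticAt ℂ (fun z : ℂ => (ordinaryHypergeometric (c - a) b c (z / (z - 1)) : ℂ)) z :=
    AnalyticAt.fun_comp (analyticOnNhd_ordinaryHypergeometric (c - a) b c (z / (z - 1))
      (mem_ball_zero_iff.2 (norm_div_sub_one_lt_one hz))) h2
  have h4 : AnalyticAt ℂ (fun z : ℂ => (1 - z) ^ (-b)) z := by
    have := one_sub_mem_slitPlane hz
    fun_prop (disch := assumption)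
  exact h4.mul h3

theorem pfaffTransform_ode (a b c : ℂ) (hc : ∀ n : ℕ, c + n ≠ 0) {z : ℂ}
    (hz : z.re < 1 / 2) (hz0 : z ≠ 0) :
    z * (1 - z) * deriv (deriv (pfaffTransform a b c)) z
      + (c - (a + b + 1) * z) * deriv (pfaffTransform a b c) z
      - a * b * pfaffTransform a b c z = 0 := by
  set f : ℂ → ℂ := ordinaryHypergeometric (c - a) b c with hf
  have hfa := analyticOnNhd_ordinaryHypergeometric (c - a) b c
  set P : ℂ → ℂ := fun z => (1 - z) ^ (-b) with hP
  -- Since q' = q², P' = bPq and z/(z−1) = 1 − q, every derivative stays polynomial in q, apart from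
  -- the factor P and the derivatives of f.
  set q : ℂ → ℂ := fun z => (1 - z)⁻¹ with hq
  have hne : ∀ {z : ℂ}, z.re < 1 / 2 → 1 - z ≠ 0 := fun hz =>
    slitPlane_ne_zero (one_sub_mem_slitPlane hz)
  have hqd : ∀ {z : ℂ}, z.re < 1 / 2 → HasDerivAt q (q z ^ 2) z := fun {z} hz => by
    have := ((hasDerivAt_id' z).const_sub 1).fun_inv (hne hz)
    simpa [hq, div_eq_mul_inv] using this
  have hPd : ∀ {z : ℂ}, z.re < 1 / 2 → HasDerivAt P (b * P z * q z) z := fun {z} hz => by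
    have := ((hasDerivAt_id' z).const_sub 1).cpow_const (c := -b) (one_sub_mem_slitPlane hz)
    refine this.congr_deriv ?_
    rw [cpow_sub _ _ (hne hz), cpow_one]
    simp [hP, hq]
    ring
  have hw : ∀ {z : ℂ}, z.re < 1 / 2 → z / (z - 1) = 1 - q z := fun {z} hz => by
    have h1 := hne hz
    have h2 : z - 1 ≠ 0 := by rwa [← neg_sub, neg_ne_zero]
    simp only [hq]
    field_simp
    ring
  have hmem : ∀ {z : ℂ}, z.re < 1 / 2 → 1 - q z ∈ ball (0 : ℂ) 1 := fun hz => by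
    rw [← hw hz]
    exact mem_ball_zero_iff.2 (norm_div_sub_one_lt_one hz)
  have hcomp : ∀ {g : ℂ → ℂ} {z : ℂ}, AnalyticOnNhd ℂ g (ball 0 1) → z.re < 1 / 2 →
      HasDerivAt (fun z => g (1 - q z)) (-(q z ^ 2) * deriv g (1 - q z)) z := fun {g z} hg hz => by
    have := (hg _ (hmem hz)).differentiableAt.hasDerivAt.comp z ((hqd hz).const_sub 1)
    exact this.congr_deriv (by ring)
  have hopen : IsOpen {z : ℂ | z.re < 1 / 2} := isOpen_lt continuous_re continuous_const
  have e0 : ∀ {z : ℂ}, z.re < 1 / 2 → pfaffTransform a b c z = P z * f (1 - q z) := fun hz => by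
    rw [← hw hz]; rfl
  have e1 : ∀ {z : ℂ}, z.re < 1 / 2 → deriv (pfaffTransform a b c) z
      = P z * (b * q z * f (1 - q z) - q z ^ 2 * deriv f (1 - q z)) := fun {z} hz => by
    have : pfaffTransform a b c =ᶠ[𝓝 z] fun z => P z * f (1 - q z) := by
      filter_upwards [hopen.mem_nhds hz] with w hw using e0 hw
    rw [this.deriv_eq, ((hPd hz).fun_mul (hcomp hfa hz)).deriv]
    ring
  have e2 : deriv (deriv (pfaffTransform a b c)) z
      = P z * (b * (b + 1) * q z ^ 2 * f (1 - q z)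
          - 2 * (b + 1) * q z ^ 3 * deriv f (1 - q z) + q z ^ 4 * deriv (deriv f) (1 - q z)) := by
    have : deriv (pfaffTransform a b c) =ᶠ[𝓝 z]
        fun z => P z * (b * q z * f (1 - q z) - q z ^ 2 * deriv f (1 - q z)) := by
      filter_upwards [hopen.mem_nhds hz] with w hw using e1 hw
    rw [this.deriv_eq, ((hPd hz).fun_mul ((((hqd hz).const_mul b).fun_mul (hcomp hfa hz)).fun_sub
      (((hqd hz).fun_pow 2).fun_mul (hcomp hfa.deriv hz)))).deriv]
    push_cast
    ring
  have hwne : 1 - q z ≠ 0 := by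
    rw [← hw hz]
    exact div_ne_zero hz0 (by rw [← neg_sub, neg_ne_zero]; exact hne hz)
  have ode := ordinaryHypergeometric_ode (c - a) b c hc (hmem hz) hwne
  have hqz : (1 - z) * q z = 1 := mul_inv_cancel₀ (hne hz)
  rw [e0 hz, e1 hz, e2]
  rw [← hf] at ode
  have hz' : z = 1 - 1 / q z := by simp [hq]
  have hq0 : q z ≠ 0 := inv_ne_zero (hne hz)
  generalize f (1 - q z) = f0 at *
  generalize deriv f (1 - q z) = f1 at *
  generalize deriv (deriv f) (1 - q z) = f2 at *
  generalize P z = p at *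
  generalize q z = r at *
  rw [hz']
  field_simp
  linear_combination (-p * r) * ode

/-- Pfaff's transformation formula. -/
theorem ordinaryHypergeometric_eq_pfaffTransform (a b c : ℂ) (hc : ∀ n : ℕ, c + n ≠ 0) :
    Set.EqOn (ordinaryHypergeometric a b c) (pfaffTransform a b c)
      (ball (0 : ℂ) 1 ∩ {z | z.re < 1 / 2}) := by
  have hA := analyticOnNhd_ordinaryHypergeometric a b c
  have hB := analyticOnNhd_pfaffTransform a b c
  have h0 : (0 : ℂ) ∈ ball (0 : ℂ) 1 ∩ {z | z.re < 1 / 2} := by simp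
  have hopen : IsOpen (ball (0 : ℂ) 1 ∩ {z | z.re < 1 / 2}) :=
    isOpen_ball.inter (isOpen_lt continuous_re continuous_const)
  refine (hA.mono Set.inter_subset_left).eqOn_of_preconnected_of_eventuallyEq
    (hB.mono Set.inter_subset_right) ?_ h0 ?_
  · exact ((convex_ball _ _).inter (convex_halfSpace_re_lt _)).isPreconnected
  · have hsub : ∀ᶠ z in 𝓝 (0 : ℂ), ((ordinaryHypergeometric a b c : ℂ → ℂ) - pfaffTransform a b c) z = 0 := by
      refine gauss_ode_eq_zero_of_apply_zero (a := a) (b := b) hc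
        ((hA 0 h0.1).sub (hB 0 h0.2)) ?_ ?_
      · simp [pfaffTransform]
      · have hd1 : ∀ z ∈ ball (0 : ℂ) 1 ∩ {z | z.re < 1 / 2},
            deriv ((ordinaryHypergeometric a b c : ℂ → ℂ) - pfaffTransform a b c) z
              = deriv (ordinaryHypergeometric a b c) z - deriv (pfaffTransform a b c) z :=
          fun z hz => deriv_sub (hA z hz.1).differentiableAt (hB z hz.2).differentiableAt
        filter_upwards [nhdsWithin_le_nhds (hopen.mem_nhds h0), self_mem_nhdsWithin] with z hz hz0
        have hd2 : deriv (deriv ((ordinaryHypergeometric a b c : ℂ → ℂ) - pfaffTransform a b c)) z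
            = deriv (deriv (ordinaryHypergeometric a b c)) z
              - deriv (deriv (pfaffTransform a b c)) z := by
          have : deriv ((ordinaryHypergeometric a b c : ℂ → ℂ) - pfaffTransform a b c) =ᶠ[𝓝 z]
              fun z => deriv (ordinaryHypergeometric a b c) z - deriv (pfaffTransform a b c) z := by
            filter_upwards [hopen.mem_nhds hz] with w hw using hd1 w hw
          rw [this.deriv_eq]
          exact deriv_fun_sub (hA.deriv z hz.1).differentiableAt (hB.deriv z hz.2).differentiableAt
        rw [hd2, hd1 z hz, Pi.sub_apply]
        linear_combination ordinaryHypergeometric_ode a b c hc hz.1 hz0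
          - pfaffTransform_ode a b c hc hz.2 hz0
    filter_upwards [hsub] with z hz using sub_eq_zero.1 hz

/-! ### The energy estimate -/

/-- The quadratic Bm² − 2Nm + s is nonnegative for every real m (by signs when m ≤ 0), so its
discriminant is at most 0. -/
theorem sq_le_mul_of_forall_two_mul_le {N s B : ℝ} (hN : 0 ≤ N)
    (h : ∀ m : ℝ, 0 < m → 2 * m * N ≤ s + m ^ 2 * B) (hs : 0 ≤ s) (hB : 0 ≤ B) :
    N ^ 2 ≤ s * B := by
  have := discrim_le_zero (a := B) (b := -(2 * N)) (c := s) fun m => by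
    rcases le_or_gt m 0 with hm | hm
    · have := mul_nonneg (mul_self_nonneg m) hB
      have := mul_nonneg (neg_nonneg.2 hm) hN
      linarith
    · linarith [h m hm]
  rw [discrim] at this
  linarith

theorem exists_norm_one_re_mul_eq_norm (w : ℂ) : ∃ z : ℂ, ‖z‖ = 1 ∧ (z * w).re = ‖w‖ := by
  rcases eq_or_ne w 0 with rfl | hw
  · exact ⟨1, by simp⟩
  · have h : (‖w‖ : ℂ) ≠ 0 := by simpa using hw
    refine ⟨(starRingEnd ℂ) w / ‖w‖, by simp [hw], ?_⟩
    rw [div_mul_eq_mul_div, mul_comm, mul_conj, normSq_eq_norm_sq]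
    push_cast
    rw [sq, mul_div_assoc, div_self h, mul_one, ofReal_re]

/-- The energy of a solution of the Gauss equation satisfied by
`₂F₁ (-β - iλ/2) (-iλ/2) (α + 1)`. -/
noncomputable def gaussEnergy (lam : ℝ) (f f1 : ℝ → ℂ) (x : ℝ) : ℝ :=
  4 * x * (1 - x) * ((f1 x).re ^ 2 + (f1 x).im ^ 2) + lam ^ 2 * ((f x).re ^ 2 + (f x).im ^ 2)

theorem hasDerivAt_re_of {f : ℝ → ℂ} {f' : ℂ} {x : ℝ} (h : HasDerivAt f f' x) :
    HasDerivAt (fun x => (f x).re) f'.re x :=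
  reCLM.hasFDerivAt.comp_hasDerivAt x h

theorem hasDerivAt_im_of {f : ℝ → ℂ} {f' : ℂ} {x : ℝ} (h : HasDerivAt f f' x) :
    HasDerivAt (fun x => (f x).im) f'.im x :=
  imCLM.hasFDerivAt.comp_hasDerivAt x h

section

variable {α β lam : ℝ} {f f1 f2 : ℝ → ℂ}

/-- The weights in the energy make the λ² cross terms cancel, and iλx|f'|² has no real part. Only
the damping and a cross term proportional to βλ survive. -/
theorem hasDerivAt_gaussEnergy {x : ℝ} (hf : HasDerivAt f (f1 x) x)
    (hf1 : HasDerivAt f1 (f2 x) x)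
    (hode : (x : ℂ) * (1 - x) * f2 x + (α + 1 - (1 - β - I * lam) * x) * f1 x
      - (I * β * lam / 2 - lam ^ 2 / 4) * f x = 0) :
    HasDerivAt (gaussEnergy lam f f1)
      (-4 * (2 * α + 1 + 2 * β * x) * ((f1 x).re ^ 2 + (f1 x).im ^ 2)
        + 4 * β * lam * ((f x).re * (f1 x).im - (f x).im * (f1 x).re)) x := by
  have hx := hasDerivAt_id' x
  have h := (((hx.const_mul 4).fun_mul (hx.const_sub 1)).fun_mul
      (((hasDerivAt_re_of hf1).fun_pow 2).fun_add ((hasDerivAt_im_of hf1).fun_pow 2))).fun_add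
    ((((hasDerivAt_re_of hf).fun_pow 2).fun_add ((hasDerivAt_im_of hf).fun_pow 2)).const_mul
      (lam ^ 2))
  refine h.congr_deriv ?_
  have hre := congrArg re hode
  have him := congrArg im hode
  have hsq_re : ((lam : ℂ) ^ 2).re = lam ^ 2 := by norm_cast
  have hsq_im : ((lam : ℂ) ^ 2).im = 0 := by norm_cast
  simp [hsq_re, hsq_im] at hre him
  push_cast
  linear_combination 8 * (f1 x).re * hre + 8 * (f1 x).im * him

/-- The energy corrected by the integrating factor that absorbs the first-order cross term. -/
noncomputable def gaussWeightedEnergy (β lam : ℝ) (f f1 : ℝ → ℂ) (x : ℝ) : ℝ :=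
  gaussEnergy lam f f1 x * Real.exp (-(|β| * Real.arcsin (2 * x - 1)))

/-- With R = 2√(x(1−x)), the inequality 2ab ≤ a² + b² bounds the cross term by (2|β|/R)E. As 2/R is
the derivative of arcsin(2x−1), the weight cancels it exactly, at the cost of a bounded factor. -/
theorem hasDerivAt_gaussWeightedEnergy_le {x : ℝ} (hβ : -(1 / 2) ≤ β) (hα : 0 < α)
    (hx0 : 0 < x) (hx1 : x < 1) (hf : HasDerivAt f (f1 x) x) (hf1 : HasDerivAt f1 (f2 x) x)
    (hode : (x : ℂ) * (1 - x) * f2 x + (α + 1 - (1 - β - I * lam) * x) * f1 x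
      - (I * β * lam / 2 - lam ^ 2 / 4) * f x = 0) :
    ∃ H' : ℝ, HasDerivAt (gaussWeightedEnergy β lam f f1) H' x ∧
      H' ≤ -(8 * α * Real.exp (-(|β| * (Real.pi / 2))) * ‖f1 x‖ ^ 2) := by
  have hE := hasDerivAt_gaussEnergy hf hf1 hode
  have harc : HasDerivAt (fun x : ℝ => Real.arcsin (2 * x - 1))
      (1 / √(1 - (2 * x - 1) ^ 2) * (2 * 1)) x :=
    HasDerivAt.comp x (h₂ := Real.arcsin) (h := fun x => 2 * x - 1)
      (Real.hasDerivAt_arcsin (x := 2 * x - 1) (by linarith) (by linarith))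
      (((hasDerivAt_id' x).const_mul 2).sub_const 1)
  have hH := hE.fun_mul ((harc.const_mul |β|).fun_neg.exp)
  refine ⟨_, hH, ?_⟩
  have hR2 : 0 < 1 - (2 * x - 1) ^ 2 := by nlinarith
  have hRsq := Real.sq_sqrt hR2.le
  have hR := Real.sqrt_pos.2 hR2
  set R := √(1 - (2 * x - 1) ^ 2) with hRdef
  have harcle : Real.arcsin (2 * x - 1) ≤ Real.pi / 2 := Real.arcsin_le_pi_div_two _
  have hw : Real.exp (-(|β| * (Real.pi / 2))) ≤ Real.exp (-(|β| * Real.arcsin (2 * x - 1))) :=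
    Real.exp_le_exp.2 (neg_le_neg (mul_le_mul_of_nonneg_left harcle (abs_nonneg β)))
  set w := Real.exp (-(|β| * Real.arcsin (2 * x - 1))) with hwdef
  have hwpos : 0 < w := Real.exp_pos _
  have hnorm : ‖f1 x‖ ^ 2 = (f1 x).re ^ 2 + (f1 x).im ^ 2 := by
    rw [Complex.sq_norm, normSq_apply]; ring
  have hEeq : gaussEnergy lam f f1 x = R ^ 2 * ((f1 x).re ^ 2 + (f1 x).im ^ 2)
      + lam ^ 2 * ((f x).re ^ 2 + (f x).im ^ 2) := by
    rw [gaussEnergy, hRsq]; ring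
  rw [hEeq, hnorm]
  generalize (f1 x).re = u
  generalize (f1 x).im = v
  generalize (f x).re = p
  generalize (f x).im = q
  have hcross : |2 * lam * (p * v - q * u) * R| ≤ R ^ 2 * (u ^ 2 + v ^ 2)
      + lam ^ 2 * (p ^ 2 + q ^ 2) := by
    rw [abs_le]
    constructor <;> nlinarith [sq_nonneg (R * v - lam * p), sq_nonneg (R * u + lam * q),
      sq_nonneg (R * v + lam * p), sq_nonneg (R * u - lam * q)]
  set E := R ^ 2 * (u ^ 2 + v ^ 2) + lam ^ 2 * (p ^ 2 + q ^ 2) with hEdef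
  have h1 : 4 * β * lam * (p * v - q * u) ≤ |β| * (1 / R * (2 * 1)) * E := by
    have : β * (2 * lam * (p * v - q * u) * R) ≤ |β| * E := by
      refine (le_abs_self _).trans ?_
      rw [abs_mul]
      exact mul_le_mul_of_nonneg_left hcross (abs_nonneg β)
    have e1 : 4 * β * lam * (p * v - q * u) = β * (2 * lam * (p * v - q * u) * R) * (2 / R) := by
      field_simp
      ring
    have e2 : |β| * (1 / R * (2 * 1)) * E = |β| * E * (2 / R) := by ring
    rw [e1, e2]
    exact mul_le_mul_of_nonneg_right this (by positivity)
  -- This is where β ≥ −1/2 enters: 1 + 2βx ≥ 0 for 0 < x < 1.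
  have h2 : 2 * α ≤ 2 * α + 1 + 2 * β * x := by nlinarith
  have h3 : 8 * α * (u ^ 2 + v ^ 2) ≤ 4 * (2 * α + 1 + 2 * β * x) * (u ^ 2 + v ^ 2) :=
    mul_le_mul_of_nonneg_right (by linarith) (by positivity)
  calc _ = w * (-4 * (2 * α + 1 + 2 * β * x) * (u ^ 2 + v ^ 2) + 4 * β * lam * (p * v - q * u)
            - |β| * (1 / R * (2 * 1)) * E) := by ring
    _ ≤ w * (-(8 * α * (u ^ 2 + v ^ 2))) :=
        mul_le_mul_of_nonneg_left (by linarith) hwpos.le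
    _ ≤ _ := by
        have := mul_le_mul_of_nonneg_right hw (show 0 ≤ 8 * α * (u ^ 2 + v ^ 2) by positivity)
        linarith

/-- A solution of the Gauss equation that equals `1` at the origin stays close to `1`. -/
theorem gauss_ode_norm_sub_one_le (hβ : -(1 / 2) ≤ β) (hα : 0 < α)
    (hf : ∀ x ∈ Set.Ico (0 : ℝ) 1, HasDerivAt f (f1 x) x)
    (hf1 : ∀ x ∈ Set.Ico (0 : ℝ) 1, HasDerivAt f1 (f2 x) x)
    (hode : ∀ x ∈ Set.Ioo (0 : ℝ) 1,
      (x : ℂ) * (1 - x) * f2 x + (α + 1 - (1 - β - I * lam) * x) * f1 x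
        - (I * β * lam / 2 - lam ^ 2 / 4) * f x = 0)
    (h0 : f 0 = 1) {s : ℝ} (hs : s ∈ Set.Ico (0 : ℝ) 1) :
    ‖f s - 1‖ ^ 2 ≤ s * (lam ^ 2 * Real.exp (|β| * Real.pi) / (8 * α)) := by
  obtain ⟨z, hz1, hz⟩ := exists_norm_one_re_mul_eq_norm (f s - 1)
  refine sq_le_mul_of_forall_two_mul_le (norm_nonneg _) (fun m hm => ?_) hs.1 (by positivity)
  set H := gaussWeightedEnergy β lam f f1 with hH
  -- Cauchy–Schwarz without integrals: 2m Re(z f') ≤ 1 + m²|f'|², and κ is scaled so that κH' ≤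
  -- −m²|f'|². Hence Φ decreases, and comparing its endpoint values gives the bound for each m.
  set κ : ℝ := m ^ 2 * (Real.exp (|β| * (Real.pi / 2)) / (8 * α)) with hκ
  have hκ0 : 0 ≤ κ := by positivity
  set Φ : ℝ → ℝ := fun x => 2 * m * (z * (f x - 1)).re - x + κ * H x with hΦ
  have hsub : Set.Icc 0 s ⊆ Set.Ico (0 : ℝ) 1 := fun x hx => ⟨hx.1, hx.2.trans_lt hs.2⟩
  have hcont : ContinuousOn Φ (Set.Icc 0 s) := by
    have c0 : ContinuousOn f (Set.Icc 0 s) := fun x hx =>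
      (hf x (hsub hx)).continuousAt.continuousWithinAt
    have c1 : ContinuousOn f1 (Set.Icc 0 s) := fun x hx =>
      (hf1 x (hsub hx)).continuousAt.continuousWithinAt
    have r0 : ContinuousOn (fun x => (f x).re) (Set.Icc 0 s) := continuous_re.comp_continuousOn c0
    have i0 : ContinuousOn (fun x => (f x).im) (Set.Icc 0 s) := continuous_im.comp_continuousOn c0
    have r1 : ContinuousOn (fun x => (f1 x).re) (Set.Icc 0 s) := continuous_re.comp_continuousOn c1
    have i1 : ContinuousOn (fun x => (f1 x).im) (Set.Icc 0 s) := continuous_im.comp_continuousOn c1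
    have hz : ContinuousOn (fun x => (z * (f x - 1)).re) (Set.Icc 0 s) :=
      continuous_re.comp_continuousOn (by fun_prop)
    have ha : ContinuousOn (fun x : ℝ => Real.exp (-(|β| * Real.arcsin (2 * x - 1))))
        (Set.Icc 0 s) := by
      have := Real.continuous_arcsin
      fun_prop
    simp only [hΦ, hH, gaussWeightedEnergy, gaussEnergy]
    fun_prop
  have hderiv : ∀ x ∈ interior (Set.Icc 0 s), ∃ d, HasDerivAt Φ d x ∧ d ≤ 0 := by
    intro x hx
    rw [interior_Icc] at hx
    have hx1 : x < 1 := hx.2.trans hs.2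
    obtain ⟨H', hH', hle⟩ := hasDerivAt_gaussWeightedEnergy_le hβ hα hx.1 hx1
      (hf x ⟨hx.1.le, hx1⟩) (hf1 x ⟨hx.1.le, hx1⟩) (hode x ⟨hx.1, hx1⟩)
    have hd := (((hasDerivAt_re_of (((hf x ⟨hx.1.le, hx1⟩).sub_const 1).const_mul z)).const_mul
      (2 * m)).fun_sub (hasDerivAt_id' x)).fun_add (hH'.const_mul κ)
    refine ⟨_, hd, ?_⟩
    have hre : (z * f1 x).re ≤ ‖f1 x‖ := by
      simpa [hz1] using re_le_norm (z * f1 x)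
    have hexp : Real.exp (|β| * (Real.pi / 2)) * Real.exp (-(|β| * (Real.pi / 2))) = 1 := by
      rw [← Real.exp_add, add_neg_cancel, Real.exp_zero]
    have hκH : κ * H' ≤ -(m ^ 2 * ‖f1 x‖ ^ 2) := by
      refine (mul_le_mul_of_nonneg_left hle hκ0).trans_eq ?_
      rw [hκ, ← mul_one (m ^ 2 * ‖f1 x‖ ^ 2), ← hexp]
      field_simp
    have := mul_le_mul_of_nonneg_left hre (show 0 ≤ 2 * m by positivity)
    nlinarith [sq_nonneg (m * ‖f1 x‖ - 1)]
  have hanti : AntitoneOn Φ (Set.Icc 0 s) := by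
    refine antitoneOn_of_deriv_nonpos (convex_Icc 0 s) hcont
      (fun x hx => ?_) (fun x hx => ?_)
    · obtain ⟨d, hd, -⟩ := hderiv x hx
      exact hd.differentiableAt.differentiableWithinAt
    · obtain ⟨d, hd, hd0⟩ := hderiv x hx
      rwa [hd.deriv]
  have hle := hanti (Set.left_mem_Icc.2 hs.1) (Set.right_mem_Icc.2 hs.1) hs.1
  have hHs : 0 ≤ κ * H s := by
    refine mul_nonneg hκ0 (mul_nonneg ?_ (Real.exp_pos _).le)
    have := hs.1
    have : 0 ≤ 1 - s := by linarith [hs.2]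
    rw [gaussEnergy]
    positivity
  have hH0 : H 0 = lam ^ 2 * Real.exp (|β| * (Real.pi / 2)) := by
    simp [hH, gaussWeightedEnergy, gaussEnergy, h0]
  have hexp : Real.exp (|β| * Real.pi)
      = Real.exp (|β| * (Real.pi / 2)) * Real.exp (|β| * (Real.pi / 2)) := by
    rw [← Real.exp_add]; ring_nf
  simp only [hΦ, hz, hH0, h0, sub_self, mul_zero, zero_re, zero_add] at hle
  have e : κ * (lam ^ 2 * Real.exp (|β| * (Real.pi / 2)))
      = m ^ 2 * (lam ^ 2 * Real.exp (|β| * Real.pi) / (8 * α)) := by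
    rw [hκ, hexp]; ring
  linarith

end

/-! ### A bound on tanh, and the continuation to (−∞, 1) -/

theorem Real.tanh_le_self {t : ℝ} (ht : 0 ≤ t) : Real.tanh t ≤ t := by
  have hmono : MonotoneOn (fun t : ℝ => t * Real.cosh t - Real.sinh t) (Set.Ici 0) := by
    have hd : ∀ x : ℝ, HasDerivAt (fun t : ℝ => t * Real.cosh t - Real.sinh t)
        (x * Real.sinh x) x := fun x => by
      refine (((hasDerivAt_id' x).fun_mul (Real.hasDerivAt_cosh x)).fun_sub
        (Real.hasDerivAt_sinh x)).congr_deriv (by ring)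
    refine monotoneOn_of_deriv_nonneg (convex_Ici 0)
      (fun x _ => (hd x).continuousAt.continuousWithinAt)
      (fun x _ => (hd x).differentiableAt.differentiableWithinAt) fun x hx => ?_
    rw [interior_Ici] at hx
    rw [(hd x).deriv]
    exact mul_nonneg hx.le (Real.sinh_nonneg_iff.2 hx.le)
  have := hmono (Set.self_mem_Ici) (Set.mem_Ici.2 ht) ht
  simp at this
  rw [Real.tanh_eq_sinh_div_cosh, div_le_iff₀ (Real.cosh_pos t)]
  exact this

/-- The Gauss series on `[0, 1)` and its Pfaff transform on `(-∞, 0)`. -/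
noncomputable def gaussGlued (a b c : ℂ) (x : ℝ) : ℂ :=
  if 0 ≤ x then ordinaryHypergeometric a b c (x : ℂ) else pfaffTransform a b c x

theorem gaussGlued_eq_series {a b c : ℂ} (hc : ∀ n : ℕ, c + n ≠ 0) {x : ℝ}
    (hx : x ∈ Set.Ioo (-1 : ℝ) 1) :
    gaussGlued a b c x = ordinaryHypergeometric a b c (x : ℂ) := by
  rw [gaussGlued]
  split_ifs with h
  · rfl
  · refine (ordinaryHypergeometric_eq_pfaffTransform a b c hc ⟨?_, ?_⟩).symm
    · simpa [abs_lt] using hx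
    · simp only [Set.mem_ofPred_eq, ofReal_re]
      linarith

theorem gaussGlued_eq_pfaffTransform {a b c : ℂ} (hc : ∀ n : ℕ, c + n ≠ 0) {x : ℝ}
    (hx : x < 1 / 2) : gaussGlued a b c x = pfaffTransform a b c x := by
  rw [gaussGlued]
  split_ifs with h
  · refine ordinaryHypergeometric_eq_pfaffTransform a b c hc ⟨?_, by simpa using hx⟩
    simp [abs_lt]
    constructor <;> linarith
  · rfl

theorem AnalyticAt.comp_ofReal {g : ℂ → ℂ} {x : ℝ} (hg : AnalyticAt ℂ g x) :
    AnalyticAt ℝ (fun x : ℝ => g x) x :=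
  hg.restrictScalars.comp (Complex.ofRealCLM.analyticAt x)

theorem isGaussContinuation_gaussGlued {a b c : ℂ} (hc : ∀ n : ℕ, c + n ≠ 0) :
    IsGaussContinuation a b c (gaussGlued a b c) := by
  refine ⟨fun x hx => ?_, fun x hx => gaussGlued_eq_series hc hx⟩
  -- Both formulas hold on (−1, 1/2), so near each point a single one describes the glued function.
  rcases lt_or_ge x (1 / 2) with h | h
  · have := (analyticOnNhd_pfaffTransform a b c (x : ℂ) (by simpa using h)).comp_ofReal
    refine this.congr ?_
    filter_upwards [Iio_mem_nhds h] with y hy using (gaussGlued_eq_pfaffTransform hc hy).symm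
  · have hx' : x ∈ Set.Ioo (-1 : ℝ) 1 := ⟨by linarith, hx⟩
    have := (analyticOnNhd_ordinaryHypergeometric a b c (x : ℂ)
      (by simpa [abs_lt] using hx')).comp_ofReal
    refine this.congr ?_
    filter_upwards [Ioo_mem_nhds hx'.1 hx'.2] with y hy using (gaussGlued_eq_series hc hy).symm

theorem gaussHypergeometric_eq_pfaffTransform {a b c : ℂ} (hc : ∀ n : ℕ, c + n ≠ 0) {x : ℝ}
    (hx : x < 1 / 2) : gaussHypergeometric a b c x = pfaffTransform a b c x := by
  have h : IsGaussContinuation a b c (gaussHypergeometric a b c) :=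
    Classical.epsilon_spec ⟨_, isGaussContinuation_gaussGlued hc⟩
  rw [h.unique (isGaussContinuation_gaussGlued hc) (show x ∈ Set.Iio 1 by
    simp only [Set.mem_Iio]; linarith), gaussGlued_eq_pfaffTransform hc hx]

theorem ofReal_add_one_add_natCast_ne_zero {α : ℝ} (hα : 0 < α) (n : ℕ) :
    (α : ℂ) + 1 + n ≠ 0 := by
  have : α + 1 + n ≠ 0 := by positivity
  exact_mod_cast this

/-! ### The Jacobi function and the final bound -/

/-- At μ = iρ − λ one has b = −iλ/2 and c − a = −β − iλ/2, so Pfaff's prefactor is (cosh² t)^{iλ/2}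
and α survives only in c. -/
theorem jacobiFunction_eq_exp_mul {α β lam t : ℝ} (hα : 0 < α) :
    jacobiFunction α β (I * ((α + β + 1 : ℝ) : ℂ) - lam) t
      = exp (I * lam * (Real.log (Real.cosh t) : ℝ))
        * ordinaryHypergeometric (-β - I * lam / 2) (-(I * lam / 2)) ((α : ℂ) + 1)
          ((Real.tanh t ^ 2 : ℝ) : ℂ) := by
  have hsq := Real.cosh_sq t
  have hcosh := Real.cosh_pos t
  rw [jacobiFunction, gaussHypergeometric_eq_pfaffTransform
    (ofReal_add_one_add_natCast_ne_zero hα) (by nlinarith [sq_nonneg (Real.sinh t)]),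
    pfaffTransform]
  have ha : (α : ℂ) + 1 - (α + β + 1 - I * (I * ((α + β + 1 : ℝ) : ℂ) - lam)) / 2
      = -β - I * lam / 2 := by
    push_cast
    linear_combination (α + β + 1 : ℂ) / 2 * I_sq
  have hb : ((α : ℂ) + β + 1 + I * (I * ((α + β + 1 : ℝ) : ℂ) - lam)) / 2 = -(I * lam / 2) := by
    push_cast
    linear_combination (α + β + 1 : ℂ) / 2 * I_sq
  have h1 : (1 : ℂ) - ((-(Real.sinh t) ^ 2 : ℝ) : ℂ) = ((Real.cosh t ^ 2 : ℝ) : ℂ) := by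
    rw [hsq]; push_cast; ring
  have hw : ((-(Real.sinh t) ^ 2 : ℝ) : ℂ) / (((-(Real.sinh t) ^ 2 : ℝ) : ℂ) - 1)
      = ((Real.tanh t ^ 2 : ℝ) : ℂ) := by
    rw [← ofReal_one, ← ofReal_sub, ← ofReal_div]
    congr 1
    rw [Real.tanh_eq_sinh_div_cosh, div_pow, hsq, ← neg_div_neg_eq]
    ring
  rw [ha, hb, hw, h1, neg_neg]
  congr 1
  have hne : ((Real.cosh t ^ 2 : ℝ) : ℂ) ≠ 0 := by
    exact_mod_cast (pow_pos hcosh 2).ne'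
  rw [cpow_def_of_ne_zero hne, ← ofReal_log (by positivity), Real.log_pow]
  congr 1
  push_cast
  ring

theorem norm_ordinaryHypergeometric_sub_one_sq_le {α β lam s : ℝ} (hβ : -(1 / 2) ≤ β)
    (hα : 0 < α) (hs : s ∈ Set.Ico (0 : ℝ) 1) :
    ‖ordinaryHypergeometric (-β - I * lam / 2) (-(I * lam / 2)) ((α : ℂ) + 1) (s : ℂ) - 1‖ ^ 2
      ≤ s * (lam ^ 2 * Real.exp (|β| * Real.pi) / (8 * α)) := by
  set F : ℂ → ℂ := ordinaryHypergeometric (-β - I * lam / 2) (-(I * lam / 2)) ((α : ℂ) + 1)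
    with hF
  have hFa : AnalyticOnNhd ℂ F (ball 0 1) := analyticOnNhd_ordinaryHypergeometric _ _ _
  have hmem : ∀ x ∈ Set.Ico (0 : ℝ) 1, (x : ℂ) ∈ ball (0 : ℂ) 1 := fun x hx => by
    simpa [abs_of_nonneg hx.1] using hx.2
  refine gauss_ode_norm_sub_one_le (f := fun x : ℝ => F x) (f1 := fun x : ℝ => deriv F x)
    (f2 := fun x : ℝ => deriv (deriv F) x) hβ hα
    (fun x hx => (hFa _ (hmem x hx)).differentiableAt.hasDerivAt.comp_ofReal)
    (fun x hx => (hFa.deriv _ (hmem x hx)).differentiableAt.hasDerivAt.comp_ofReal)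
    (fun x hx => ?_) (by simp [hF]) hs
  have := ordinaryHypergeometric_ode (-β - I * lam / 2) (-(I * lam / 2)) ((α : ℂ) + 1)
    (ofReal_add_one_add_natCast_ne_zero hα) (hmem x ⟨hx.1.le, hx.2⟩)
    (by exact_mod_cast hx.1.ne')
  rw [← hF] at this
  linear_combination this + (lam : ℂ) ^ 2 / 4 * F x * I_sq

theorem mainTheorem9 (β : ℝ) (hβ : -(1 / 2 : ℝ) ≤ β) :
    ∃ C : ℝ, ∀ t : ℝ, 0 ≤ t → ∀ α : ℝ, max β 0 < α → ∀ lam : ℝ,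
      ‖jacobiFunction α β (Complex.I * ((α + β + 1 : ℝ) : ℂ) - (lam : ℂ)) t
          - Complex.exp (Complex.I * (lam : ℂ) * ((Real.log (Real.cosh t) : ℝ) : ℂ))‖
        ≤ C * (|lam| * min 1 t / Real.sqrt α) := by
  refine ⟨√(Real.exp (|β| * Real.pi) / 8), fun t ht α hα lam => ?_⟩
  have hα0 : 0 < α := (le_max_right β 0).trans_lt hα
  have htanh0 : 0 ≤ Real.tanh t := by
    rw [Real.tanh_eq_sinh_div_cosh]
    exact div_nonneg (Real.sinh_nonneg_iff.2 ht) (Real.cosh_pos t).le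
  have htanh1 : Real.tanh t < 1 := Real.tanh_lt_one t
  have htanh : Real.tanh t ≤ min 1 t := le_min htanh1.le (Real.tanh_le_self ht)
  rw [jacobiFunction_eq_exp_mul hα0, ← mul_sub_one, norm_mul,
    show I * (lam : ℂ) * (Real.log (Real.cosh t) : ℝ)
      = ((lam * Real.log (Real.cosh t) : ℝ) : ℂ) * I by push_cast; ring,
    norm_exp_ofReal_mul_I, one_mul]
  have hmin : 0 ≤ min 1 t := le_min zero_le_one ht
  refine le_of_sq_le_sq ?_ (by positivity)
  refine (norm_ordinaryHypergeometric_sub_one_sq_le hβ hα0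
    ⟨by positivity, by nlinarith⟩).trans ?_
  rw [mul_pow, div_pow, mul_pow, Real.sq_sqrt (by positivity), Real.sq_sqrt hα0.le, sq_abs]
  calc Real.tanh t ^ 2 * (lam ^ 2 * Real.exp (|β| * Real.pi) / (8 * α))
      ≤ min 1 t ^ 2 * (lam ^ 2 * Real.exp (|β| * Real.pi) / (8 * α)) := by gcongr
    _ = _ := by field_simp
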